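/- Let $K$ be an ordered field and let $\mathcal L=\{<,0,+,(k)_{k\in K},(k(x))_{k\in K}\}$ be the language of ordered $K$-vector spaces, with a constant symbol and a scalar-multiplication symbol for each $k\in K$. Let $VS$ be the $\mathcal L$-theory of ordered $K$-vector spaces in which the constant $1$ is positive and the constant $k$ is interpreted as $k\cdot 1$. Let $VS_{\mathcal G}$ be the theory in $\mathcal L\cup\{\mathcal G\}$ which says, in addition to $VS$, that the unary predicate $\mathcal G$ is a divisible subgroup that is dense and codense, and let $VS^*_{\mathcal G}$ be the model companion of $VS_{\mathcal G}$. Let $(\mathcal R,\mathcal G)\models VS^*_{\mathcal G}$; types, algebraic closure and implications between sets of formulas are taken in $\mathcal L\cup\{\mathcal G\}$, where a set of formulas in the variable $x$ with parameters from $R$ implies another one if, in every elementary extension of $(\mathcal R,\mathcal G)$, every element satisfying the first satisfies the second. For $C\subseteq R$, let $K\langle C\rangle$ be the $K$-linear span of $C\cup\{1\}$. The cut of $r\in R$ in a set $B\subseteq R$ consists of those formulas $b<x$, $x<b$, $x=b$ $(b\in B)$ that $r$ satisfies. The coset type of $r$ over $C$ consists of all formulas $ux-(\vec v\cdot\vec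 c+k)\in\mathcal G$ and $ux-(\vec v\cdot\vec c+k)\notin\mathcal G$ that $r$ satisfies, where $\vec c$ is a finite tuple from $C$ and $u,k$ and the entries of $\vec v$ are in $K$. A set $C$ is $\operatorname{acl}$-independent if $c\notin\operatorname{acl}(C\setminus\{c\})$ for all $c\in C$. Then $\operatorname{acl}(C)=K\langle C\rangle$ for every $C\subseteq R$, and for each $r\in R$ the following hold. 1. For every $\operatorname{acl}$-independent set $C\subseteq R$, the type $\operatorname{tp}(r/C)$ is implied by the cut of $r$ in $\operatorname{acl}(C)=K\langle C\rangle$ together with the coset type of $r$ over $C$. 2. Suppose that $K$ is finite-dimensional over $\mathbb Q$, and let $n\ge 1$ and $\eta_1,\dots,\eta_n\in K$. (a) If $K=\mathbb Q(\eta_1,\dots,\eta_n)$, then there are $d_1,\dots,d_n\in R$ such that for every $C\subseteq R$ containing $d_1,\dots,d_n$, the type $\operatorname{tp}(r/C)$ is implied by the cut of $r$ in $K\langle C\rangle$ together with the coset type of $r$ over $\{d_1,\dots,d_n\}$. (b) If $\eta_1,\dots,\eta_n$ span $K$ as a vector space over $\mathbb Q$, then any $d_1,\dots,d_n\in R$ with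 $\eta_j r-d_j\in\mathcal G$ for $j=1,\dots,n$ have the property in (a). -/

import Mathlib

open FirstOrder FirstOrder.Language

universe u v w

section ModelTheory

variable {L : FirstOrder.Language.{u, v}} {M : Type w} [L.Structure M]

/-- The model-theoretic algebraic closure of `A`: all elements that lie in a finite set which is
definable with parameters from `A`. -/
def acl (L : FirstOrder.Language.{u, v}) {M : Type w} [L.Structure M] (A : Set M) : Set M :=
  {b | ∃ S : Set M, S.Finite ∧ A.Definable₁ L S ∧ b ∈ S}

/-- `A` is acl-independent: no element of `A` is algebraic over the remaining ones. -/
def AclIndependent (L : FirstOrder.Language.{u, v}) {M : Type w} [L.Structure M] (A : Set M) : Prop :=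
  ∀ a ∈ A, a ∉ acl L (A \ {a})

/-- Formulas in one free variable `x` (the variable `Sum.inr ()`) with parameters from `M`
(the parameter `b` is the variable `Sum.inl b`). -/
abbrev ParamFormula (L : FirstOrder.Language.{u, v}) (M : Type w) : Type (max u v w) :=
  L.Formula (M ⊕ Unit)

/-- The element `s` of the structure `N` satisfies the formula `φ`, where the parameters from `M`
are interpreted in `N` through `f : M → N`. -/
def ParamFormula.Holds {N : Type w} [L.Structure N] (φ : ParamFormula L M) (f : M → N) (s : N) :
    Prop :=
  Formula.Realize φ (Sum.elim f fun _ => s)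

/-- The complete type of `r` over `C`: all formulas with parameters from `C` that `r` satisfies. -/
def tp (L : FirstOrder.Language.{u, v}) {M : Type w} [L.Structure M] (r : M) (C : Set M) :
    Set (ParamFormula L M) :=
  {φ | φ.Holds id r ∧
    ∃ ψ : L.Formula (C ⊕ Unit), φ = Formula.relabel (Sum.map Subtype.val id) ψ}

/-- The set of formulas `p` implies the set of formulas `q`: in every elementary extension of `M`,
every element that satisfies all of `p` satisfies all of `q`. -/
def Implies (p q : Set (ParamFormula L M)) : Prop :=
  ∀ (N : Type w) [L.Structure N] (f : M ↪ₑ[L] N) (s : N),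
    (∀ φ ∈ p, φ.Holds f s) → ∀ ψ ∈ q, ψ.Holds f s

end ModelTheory

/-- `T` is model complete: every embedding between models of `T` is elementary. -/
def IsModelComplete {L : FirstOrder.Language.{u, 0}} (T : L.Theory) : Prop :=
  ∀ (M N : Theory.ModelType.{u, 0, u} T) (f : M ↪[L] N) (n : ℕ) (φ : L.Formula (Fin n))
    (a : Fin n → M), φ.Realize (f ∘ a) ↔ φ.Realize a

/-- `T'` is a model companion of `T`: it is model complete, every model of `T` embeds into a model
of `T'`, and every model of `T'` embeds into a model of `T`. -/
structure IsModelCompanion {L : FirstOrder.Language.{u, 0}} (T T' : L.Theory) : Prop where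
  modelComplete : IsModelComplete T'
  embeds : ∀ M : Theory.ModelType.{u, 0, u} T, ∃ N : Theory.ModelType.{u, 0, u} T',
    Nonempty (M ↪[L] N)
  embeds' : ∀ N : Theory.ModelType.{u, 0, u} T', ∃ M : Theory.ModelType.{u, 0, u} T,
    Nonempty (N ↪[L] M)

namespace VS

/-- Function symbols of the language of ordered `K`-vector spaces: `0`, a constant for each element
of `K`, multiplication by each scalar in `K`, and `+`. -/
inductive Func (K : Type u) : ℕ → Type u
  | zero : Func K 0
  | const (k : K) : Func K 0
  | smul (k : K) : Func K 1
  | add : Func K 2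

/-- The relation symbol `<`. -/
inductive Rel : ℕ → Type
  | lt : Rel 2

/-- The unary relation symbol for the subgroup. -/
inductive GRel : ℕ → Type
  | mem : GRel 1

/-- The language of ordered `K`-vector spaces with constants from `K`. -/
def lang (K : Type u) : FirstOrder.Language.{u, 0} := ⟨Func K, Rel⟩

/-- The language with a single unary predicate. -/
def predLang : FirstOrder.Language.{0, 0} := ⟨fun _ => Empty, GRel⟩

/-- The language of ordered `K`-vector spaces, expanded by a unary predicate `G`. -/
abbrev langG (K : Type u) : FirstOrder.Language.{u, 0} := (lang K).sum predLang

section Symbols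

variable {K : Type u}

def zeroSymb : (lang K).Constants := Func.zero

def constSymb (k : K) : (lang K).Constants := Func.const k

def smulSymb (k : K) : (lang K).Functions 1 := Func.smul k

def addSymb : (lang K).Functions 2 := Func.add

def ltSymb : (lang K).Relations 2 := Rel.lt

def memSymb : (langG K).Relations 1 := Sum.inr GRel.mem

end Symbols

section Terms

variable {K : Type u} {α : Type w} {n : ℕ}

def tzero : (lang K).Term α := Constants.term zeroSymb

def tconst (k : K) : (lang K).Term α := Constants.term (constSymb k)

def tsmul (k : K) (t : (lang K).Term α) : (lang K).Term α :=
  Functions.apply₁ (smulSymb k) t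

def tadd (s t : (lang K).Term α) : (lang K).Term α :=
  Functions.apply₂ addSymb s t

def flt (s t : (lang K).Term (α ⊕ Fin n)) : (lang K).BoundedFormula α n :=
  Relations.boundedFormula₂ ltSymb s t

/-- The formula `t ∈ G`, for a term `t` in the language of ordered vector spaces. -/
def fmem (t : (lang K).Term (α ⊕ Fin n)) : (langG K).BoundedFormula α n :=
  Relations.boundedFormula₁ memSymb (LHom.sumInl.onTerm t)

/-- The linear combination `v₁ c₁ + ⋯ + vₘ cₘ + k`, for `l = [(v₁, c₁), …, (vₘ, cₘ)]`. -/
def tlin (k : K) (l : List (K × α)) : (lang K).Term α :=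
  l.foldr (fun p t => tadd (tsmul p.1 (Term.var p.2)) t) (tconst k)

end Terms

section Theories

variable (K : Type u) [Field K] [LinearOrder K]

/-- The theory of ordered vector spaces over the ordered field `K`, with the constants from `K`
naming the multiples of a positive element `1`. -/
inductive Ax : (lang K).Sentence → Prop
  | add_assoc : Ax (∀' ∀' ∀' (tadd (tadd (&0) (&1)) (&2) =' tadd (&0) (tadd (&1) (&2))))
  | add_comm : Ax (∀' ∀' (tadd (&0) (&1) =' tadd (&1) (&0)))
  | add_zero : Ax (∀' (tadd (&0) tzero =' &0))
  | add_neg : Ax (∀' (tadd (&0) (tsmul (-1) (&0)) =' tzero))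
  | one_smul : Ax (∀' (tsmul 1 (&0) =' &0))
  | mul_smul (k l : K) : Ax (∀' (tsmul (k * l) (&0) =' tsmul k (tsmul l (&0))))
  | add_smul (k l : K) : Ax (∀' (tsmul (k + l) (&0) =' tadd (tsmul k (&0)) (tsmul l (&0))))
  | smul_add (k : K) :
      Ax (∀' ∀' (tsmul k (tadd (&0) (&1)) =' tadd (tsmul k (&0)) (tsmul k (&1))))
  | lt_irrefl : Ax (∀' ∼(flt (&0) (&0)))
  | lt_trans : Ax (∀' ∀' ∀' (flt (&0) (&1) ⟹ flt (&1) (&2) ⟹ flt (&0) (&2)))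
  | lt_trichotomy : Ax (∀' ∀' (flt (&0) (&1) ⊔ ((&0 =' &1) ⊔ flt (&1) (&0))))
  | add_lt_add : Ax (∀' ∀' ∀' (flt (&0) (&1) ⟹ flt (tadd (&0) (&2)) (tadd (&1) (&2))))
  | smul_pos (k : K) (hk : 0 < k) : Ax (∀' (flt tzero (&0) ⟹ flt tzero (tsmul k (&0))))
  | const_eq (k : K) : Ax (tconst k =' tsmul k (tconst 1))
  | one_pos : Ax (flt tzero (tconst 1))

/-- The axioms stating that `G` is a divisible subgroup which is dense and codense. -/
inductive GAx : (langG K).Sentence → Prop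
  | zero_mem : GAx (fmem tzero)
  | add_mem : GAx (∀' ∀' (fmem (&0) ⟹ fmem (&1) ⟹ fmem (tadd (&0) (&1))))
  | neg_mem : GAx (∀' (fmem (&0) ⟹ fmem (tsmul (-1) (&0))))
  | divisible (n : ℕ) (hn : 0 < n) :
      GAx (∀' (fmem (&0) ⟹
        ∃' (fmem (&1) ⊓ LHom.sumInl.onBoundedFormula (tsmul (n : K) (&1) =' &0))))
  | dense : GAx (∀' ∀' (LHom.sumInl.onBoundedFormula (flt (&0) (&1)) ⟹
      ∃' (fmem (&2) ⊓ LHom.sumInl.onBoundedFormula (flt (&0) (&2) ⊓ flt (&2) (&1)))))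
  | codense : GAx (∀' ∀' (LHom.sumInl.onBoundedFormula (flt (&0) (&1)) ⟹
      ∃' (∼(fmem (&2)) ⊓ LHom.sumInl.onBoundedFormula (flt (&0) (&2) ⊓ flt (&2) (&1)))))

/-- The theory `VS` of ordered `K`-vector spaces. -/
def theory : (lang K).Theory := {φ | Ax K φ}

/-- The theory `VS_G` of ordered `K`-vector spaces with a dense and codense divisible subgroup. -/
def theoryG : (langG K).Theory := LHom.sumInl.onTheory (theory K) ∪ {φ | GAx K φ}

end Theories

section Types

variable {K : Type u} {R : Type w} [(langG K).Structure R]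

/-- `K⟨C⟩`: the closure of `C` under the function symbols of the language, that is, the `K`-linear
span of `C` and of the constants. -/
def spanSet (K : Type u) {R : Type w} [(langG K).Structure R] (C : Set R) : Set R :=
  Substructure.closure (langG K) C

/-- The parameter `b`, as a term. -/
def tpar (b : R) : (lang K).Term ((R ⊕ Unit) ⊕ Fin 0) := Term.var (Sum.inl (Sum.inl b))

/-- The free variable `x`, as a term. -/
def tx : (lang K).Term ((R ⊕ Unit) ⊕ Fin 0) := Term.var (Sum.inl (Sum.inr ()))

/-- The formula `b < x`. -/
def belowFormula (K : Type u) {R : Type w} (b : R) : ParamFormula (langG K) R :=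
  LHom.sumInl.onFormula (flt (tpar (K := K) b) tx)

/-- The formula `x < b`. -/
def aboveFormula (K : Type u) {R : Type w} (b : R) : ParamFormula (langG K) R :=
  LHom.sumInl.onFormula (flt (tx (K := K)) (tpar b))

/-- The formula `x = b`. -/
def eqFormula (K : Type u) {R : Type w} (b : R) : ParamFormula (langG K) R :=
  LHom.sumInl.onFormula (tx (K := K) =' tpar b)

/-- The `<`-cut of `r` in `B`: for each `b ∈ B`, the one of the formulas `b < x`, `x < b`, `x = b`
that `r` satisfies. -/
def cut (K : Type u) {R : Type w} [(langG K).Structure R] (r : R) (B : Set R) :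
    Set (ParamFormula (langG K) R) :=
  {φ | φ.Holds id r ∧ ∃ b ∈ B, φ = belowFormula K b ∨ φ = aboveFormula K b ∨ φ = eqFormula K b}

/-- The formula `u x - (v₁ c₁ + ⋯ + vₘ cₘ + k) ∈ G`, for `l = [(v₁, c₁), …, (vₘ, cₘ)]`. -/
def cosetFormula {K : Type u} [Field K] {R : Type w} (u k : K) (l : List (K × R)) :
    ParamFormula (langG K) R :=
  fmem (tadd (tsmul u tx)
    (tsmul (-1) (tlin k (l.map fun p => (p.1, Sum.inl (Sum.inl p.2))))))

/-- The coset type of `r` over `C`: all formulas `u x - (v · c + k) ∈ G` and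
`u x - (v · c + k) ∉ G`, where `c` is a tuple from `C`, that `r` satisfies. -/
def cosetType (K : Type u) [Field K] {R : Type w} [(langG K).Structure R] (r : R) (C : Set R) :
    Set (ParamFormula (langG K) R) :=
  {φ | φ.Holds id r ∧ ∃ (u k : K) (l : List (K × R)), (∀ p ∈ l, p.2 ∈ C) ∧
    (φ = cosetFormula u k l ∨ φ = Formula.not (cosetFormula u k l))}

end Types

end VS

/-!
The proof replaces quantifier elimination by amalgamation. A model of the model companion embeds in
a model of `theoryG K`, so it is an ordered `K`-vector space with a proper subgroup `G` that is a
`ℚ`-subspace (`exists_groupPair_of_model`). Let `D` be a partial isomorphism between two such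
models, that is, the graph of an isomorphism between `K`-subspaces containing `1` which respects
order and subgroups. The pushout of the two models over `D` is ordered by extending the cone of
sums of nonnegative elements to a total one, and its subgroup is the sum of the two subgroups; it
contains both models, and they intersect only in the domain of `D`
(`IsPartialIso.exists_amalgam`). Every ordered vector space `V` with a proper subgroup `G` embeds in
a model of `theoryG K`: take the finitely supported sequences in `V` with the lexicographic order,
and the subgroup of those whose sum lies in `G` (`exists_embedding_model`). That model embeds in a
model of the model companion, and by model completeness both given models are elementary in the
result (`IsPartialIso.exists_elementary_amalgam`).

Hence partial isomorphisms are elementary, and two copies of a model can be amalgamated over the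
span of `C` so that an element outside the span has a second conjugate outside the first copy; this
gives `acl C = K⟨C⟩` (`acl_subset_spanSet`). For types, the cut of `r` over the span of `C` and the
cosets of `G` that contain the elements `u r - b`, with `u` in `K` and `b` in the span, determine
the isomorphism type of the span of `C` and `r` over the span of `C`, hence `tp(r/C)`
(`holds_of_mem_tp`). The coset type over `C` contains exactly this information about cosets. If
each `u r` is known to lie in the coset of some element of the span, all of it follows
(`mem_G_iff_of_forall_exists`), and it is enough to know this for scalars `u` that span `K` over `ℚ`
(`exists_coset_of_span_eq_top`). If `K` is finite-dimensional over `ℚ`, then some line `K x` is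
contained in `G` (`exists_line_subset_G`), because this holds in the lexicographic extension and is
expressed there by a single sentence; the single parameter `d = r + x` then suffices.
-/

namespace VS

/-! ### Interpretations of the symbols -/

section Operations

variable (K : Type u) {V : Type u} [(langG K).Structure V]

/-- The reduct of a structure to the language of ordered vector spaces. -/
instance reductStructure (V : Type u) [(langG K).Structure V] : (lang K).Structure V :=
  (LHom.sumInl : lang K →ᴸ langG K).reduct V

/-- The interpretation of `0`. -/
def opZero (V : Type u) [(langG K).Structure V] : V :=
  Structure.funMap (L := langG K) (Sum.inl Func.zero) ![]

/-- The interpretation of the constant symbol `k`. -/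
def opConst {K : Type u} (V : Type u) [(langG K).Structure V] (k : K) : V :=
  Structure.funMap (L := langG K) (Sum.inl (Func.const k)) ![]

/-- The interpretation of scalar multiplication by `k`. -/
def opSMul {K : Type u} {V : Type u} [(langG K).Structure V] (k : K) (x : V) : V :=
  Structure.funMap (L := langG K) (Sum.inl (Func.smul k)) ![x]

/-- The interpretation of `+`. -/
def opAdd (x y : V) : V :=
  Structure.funMap (L := langG K) (Sum.inl Func.add) ![x, y]

/-- The interpretation of `<`. -/
def OpLt (x y : V) : Prop :=
  Structure.RelMap (L := langG K) (Sum.inl Rel.lt) ![x, y]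

/-- The interpretation of the predicate for the subgroup. -/
def OpMem (x : V) : Prop :=
  Structure.RelMap (L := langG K) (Sum.inr GRel.mem) ![x]

variable {K} {α : Type*} {n : ℕ}

@[simp] lemma realize_tzero (v : α → V) :
    (tzero : (lang K).Term α).realize v = opZero K V := by
  rw [tzero, Term.realize_constants]
  exact congrArg (Structure.funMap (L := langG K) (Sum.inl Func.zero)) (Subsingleton.elim _ _)

@[simp] lemma realize_tconst (k : K) (v : α → V) :
    (tconst k : (lang K).Term α).realize v = opConst V k := by
  rw [tconst, Term.realize_constants]
  exact congrArg (Structure.funMap (L := langG K) (Sum.inl (Func.const k))) (Subsingleton.elim _ _)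

@[simp] lemma realize_tsmul (k : K) (t : (lang K).Term α) (v : α → V) :
    (tsmul k t).realize v = opSMul k (t.realize v) :=
  Term.realize_functions_apply₁

@[simp] lemma realize_tadd (s t : (lang K).Term α) (v : α → V) :
    (tadd s t).realize v = opAdd K (s.realize v) (t.realize v) :=
  Term.realize_functions_apply₂

@[simp] lemma realize_flt (s t : (lang K).Term (α ⊕ Fin n)) (v : α → V) (x : Fin n → V) :
    (flt s t).Realize v x ↔
      OpLt K (s.realize (Sum.elim v x)) (t.realize (Sum.elim v x)) :=
  BoundedFormula.realize_rel₂

@[simp] lemma realize_fmem (t : (lang K).Term (α ⊕ Fin n)) (v : α → V) (x : Fin n → V) :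
    (fmem t).Realize v x ↔ OpMem K (t.realize (Sum.elim v x)) := by
  rw [fmem, BoundedFormula.realize_rel₁, LHom.realize_onTerm]
  rfl

section Maps

variable {W : Type u} [(langG K).Structure W] (f : V ↪[langG K] W)

lemma map_opZero : f (opZero K V) = opZero K W :=
  (f.map_fun _ _).trans (congrArg _ (Subsingleton.elim _ _))

lemma map_opConst (k : K) : f (opConst V k) = opConst W k :=
  (f.map_fun _ _).trans (congrArg _ (Subsingleton.elim _ _))

lemma map_opSMul (k : K) (x : V) : f (opSMul k x) = opSMul k (f x) :=
  (f.map_fun _ _).trans (congrArg _ (by ext i; fin_cases i; rfl))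

lemma map_opAdd (x y : V) : f (opAdd K x y) = opAdd K (f x) (f y) :=
  (f.map_fun _ _).trans (congrArg _ (by ext i; fin_cases i <;> rfl))

lemma map_opLt (x y : V) : OpLt K (f x) (f y) ↔ OpLt K x y :=
  Iff.trans (Eq.to_iff (congrArg (Structure.RelMap _) (by ext i; fin_cases i <;> rfl)))
    (f.map_rel _ _)

lemma map_opMem (x : V) : OpMem K (f x) ↔ OpMem K x :=
  Iff.trans (Eq.to_iff (congrArg (Structure.RelMap _) (by ext i; fin_cases i; rfl))) (f.map_rel _ _)

end Maps

end Operations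

/-- The axioms on the interpretation of the symbols that pass to substructures: `V` is an ordered
vector space, and the predicate is a subgroup closed under division by positive integers. -/
structure OpAxioms (K : Type u) [Field K] [LinearOrder K] (V : Type u) [(langG K).Structure V] :
    Prop where
  add_assoc (x y z : V) : opAdd K (opAdd K x y) z = opAdd K x (opAdd K y z)
  add_comm (x y : V) : opAdd K x y = opAdd K y x
  add_zero (x : V) : opAdd K x (opZero K V) = x
  add_neg (x : V) : opAdd K x (opSMul (-1 : K) x) = opZero K V
  one_smul (x : V) : opSMul (1 : K) x = x
  mul_smul (k l : K) (x : V) : opSMul (k * l) x = opSMul k (opSMul l x)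
  add_smul (k l : K) (x : V) : opSMul (k + l) x = opAdd K (opSMul k x) (opSMul l x)
  smul_add (k : K) (x y : V) : opSMul k (opAdd K x y) = opAdd K (opSMul k x) (opSMul k y)
  lt_irrefl (x : V) : ¬ OpLt K x x
  lt_trans (x y z : V) : OpLt K x y → OpLt K y z → OpLt K x z
  lt_trichotomy (x y : V) : OpLt K x y ∨ x = y ∨ OpLt K y x
  add_lt_add (x y z : V) : OpLt K x y → OpLt K (opAdd K x z) (opAdd K y z)
  smul_pos (k : K) (hk : 0 < k) (x : V) :
    OpLt K (opZero K V) x → OpLt K (opZero K V) (opSMul k x)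
  const_eq (k : K) : opConst V k = opSMul k (opConst V (1 : K))
  one_pos : OpLt K (opZero K V) (opConst V (1 : K))
  zero_mem : OpMem K (opZero K V)
  add_mem (x y : V) : OpMem K x → OpMem K y → OpMem K (opAdd K x y)
  neg_mem (x : V) : OpMem K x → OpMem K (opSMul (-1 : K) x)
  inv_smul_mem (n : ℕ) (hn : 0 < n) (x : V) : OpMem K x → OpMem K (opSMul (n : K)⁻¹ x)

section Axioms

variable {K : Type u} [Field K] [LinearOrder K] {V : Type u} [(langG K).Structure V]

theorem OpAxioms.of_model [IsStrictOrderedRing K] (h : V ⊨ theoryG K) : OpAxioms K V := by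
  have h₁ : V ⊨ theory K :=
    (LHom.onTheory_model (LHom.sumInl : lang K →ᴸ langG K) (theory K)).1
      (h.mono Set.subset_union_left)
  have h₂ {φ : (langG K).Sentence} (hφ : GAx K φ) : V ⊨ φ :=
    h.realize_of_mem φ (Or.inr hφ)
  replace h₁ {φ : (lang K).Sentence} (hφ : Ax K φ) : V ⊨ φ := h₁.realize_of_mem φ hφ
  have mul_smul (k l : K) (x : V) : opSMul (k * l) x = opSMul k (opSMul l x) := by
    simpa [Sentence.Realize, Formula.Realize, Fin.snoc] using h₁ (.mul_smul k l) x
  have one_smul (x : V) : opSMul (1 : K) x = x := by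
    simpa [Sentence.Realize, Formula.Realize, Fin.snoc] using h₁ .one_smul x
  constructor
  case mul_smul => exact mul_smul
  case one_smul => exact one_smul
  case inv_smul_mem =>
    intro n hn x hx
    obtain ⟨y, hy, rfl⟩ : ∃ y : V, OpMem K y ∧ opSMul (n : K) y = x := by
      have := h₂ (.divisible n hn)
      simp only [Sentence.Realize, Formula.Realize, BoundedFormula.realize_all,
        BoundedFormula.realize_imp, BoundedFormula.realize_ex, BoundedFormula.realize_inf,
        realize_fmem, LHom.realize_onBoundedFormula, BoundedFormula.realize_bdEqual,
        realize_tsmul] at this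
      exact this x hx
    rwa [← mul_smul, inv_mul_cancel₀ (by positivity), one_smul]
  case smul_pos =>
    intro k hk
    simpa [Sentence.Realize, Formula.Realize, Fin.snoc] using h₁ (.smul_pos k hk)
  case const_eq =>
    intro k
    simpa [Sentence.Realize, Formula.Realize, Fin.snoc] using h₁ (.const_eq k)
  case add_smul =>
    intro k l
    simpa [Sentence.Realize, Formula.Realize, Fin.snoc] using h₁ (.add_smul k l)
  case smul_add =>
    intro k
    simpa [Sentence.Realize, Formula.Realize, Fin.snoc] using h₁ (.smul_add k)
  case add_assoc => simpa [Sentence.Realize, Formula.Realize, Fin.snoc] using h₁ .add_assoc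
  case add_comm => simpa [Sentence.Realize, Formula.Realize, Fin.snoc] using h₁ .add_comm
  case add_zero => simpa [Sentence.Realize, Formula.Realize, Fin.snoc] using h₁ .add_zero
  case add_neg => simpa [Sentence.Realize, Formula.Realize, Fin.snoc] using h₁ .add_neg
  case lt_irrefl => simpa [Sentence.Realize, Formula.Realize, Fin.snoc] using h₁ .lt_irrefl
  case lt_trans => simpa [Sentence.Realize, Formula.Realize, Fin.snoc] using h₁ .lt_trans
  case lt_trichotomy =>
    simpa [Sentence.Realize, Formula.Realize, Fin.snoc] using h₁ .lt_trichotomy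
  case add_lt_add =>
    simpa [Sentence.Realize, Formula.Realize, Fin.snoc] using h₁ .add_lt_add
  case one_pos => simpa [Sentence.Realize, Formula.Realize, Fin.snoc] using h₁ .one_pos
  case zero_mem => simpa [Sentence.Realize, Formula.Realize, Fin.snoc] using h₂ .zero_mem
  case add_mem => simpa [Sentence.Realize, Formula.Realize, Fin.snoc] using h₂ .add_mem
  case neg_mem => simpa [Sentence.Realize, Formula.Realize, Fin.snoc] using h₂ .neg_mem

theorem OpAxioms.of_embedding {W : Type u} [(langG K).Structure W] (f : V ↪[langG K] W)
    (h : OpAxioms K W) : OpAxioms K V := by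
  constructor
  case lt_irrefl => exact fun x hx => h.lt_irrefl _ ((map_opLt f _ _).2 hx)
  case lt_trans =>
    exact fun x y z => by simpa only [map_opLt] using h.lt_trans (f x) (f y) (f z)
  case lt_trichotomy =>
    exact fun x y => by
      simpa only [map_opLt, f.injective.eq_iff] using h.lt_trichotomy (f x) (f y)
  case add_lt_add =>
    exact fun x y z => by
      simpa only [← map_opAdd, map_opLt] using h.add_lt_add (f x) (f y) (f z)
  case smul_pos =>
    exact fun k hk x => by
      simpa only [← map_opSMul, ← map_opZero f, map_opLt] using h.smul_pos k hk (f x)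
  case one_pos => simpa only [← map_opConst f, ← map_opZero f, map_opLt] using h.one_pos
  case zero_mem => simpa only [← map_opZero f, map_opMem] using h.zero_mem
  case add_mem =>
    exact fun x y => by simpa only [← map_opAdd, map_opMem] using h.add_mem (f x) (f y)
  case neg_mem =>
    exact fun x => by simpa only [← map_opSMul, map_opMem] using h.neg_mem (f x)
  case inv_smul_mem =>
    exact fun n hn x => by
      simpa only [← map_opSMul, map_opMem] using h.inv_smul_mem n hn (f x)
  all_goals
    intros
    apply f.injective
    simp only [map_opAdd, map_opSMul, map_opZero, map_opConst]
  case add_assoc => exact h.add_assoc _ _ _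
  case add_comm => exact h.add_comm _ _
  case add_zero => exact h.add_zero _
  case add_neg => exact h.add_neg _
  case one_smul => exact h.one_smul _
  case mul_smul => exact h.mul_smul _ _ _
  case add_smul => exact h.add_smul _ _ _
  case smul_add => exact h.smul_add _ _ _
  case const_eq => exact h.const_eq _

end Axioms

/-! ### Ordered vector spaces with a subgroup -/

/-- The data that turn an ordered `K`-vector space into a structure for the language with the
predicate: a positive element named `1` and a proper subgroup that is closed under multiplication
by rational numbers. It is not a `K`-subspace in general. -/
class GroupPair (K : Type u) [Field K] (V : Type u) [AddCommGroup V] [LinearOrder V]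
    [Module K V] where
  /-- The element named by the constant `1`. -/
  one : V
  one_pos : 0 < one
  /-- The distinguished subgroup. -/
  G : AddSubgroup V
  rat_smul_mem : ∀ (q : ℚ) {x : V}, x ∈ G → (q : K) • x ∈ G
  exists_notMem : ∃ x, x ∉ G

section Structure

variable (K : Type u) [Field K] (V : Type u) [AddCommGroup V] [LinearOrder V] [Module K V]
  [GroupPair K V]

instance GroupPair.structure : (langG K).Structure V where
  funMap := fun f => match f with
    | Sum.inl .zero => fun _ => 0
    | Sum.inl (.const k) => fun _ => k • GroupPair.one K
    | Sum.inl (.smul k) => fun x => k • x 0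
    | Sum.inl .add => fun x => x 0 + x 1
    | Sum.inr f => nomatch f
  RelMap := fun r => match r with
    | Sum.inl .lt => fun x => x 0 < x 1
    | Sum.inr .mem => fun x => x 0 ∈ GroupPair.G K (V := V)

variable {V}

@[simp] lemma opZero_eq : opZero K V = 0 := rfl

@[simp] lemma opConst_eq (k : K) : opConst V k = k • GroupPair.one K := rfl

@[simp] lemma opSMul_eq (k : K) (x : V) : opSMul k x = k • x := rfl

@[simp] lemma opAdd_eq (x y : V) : opAdd K x y = x + y := rfl

@[simp] lemma opLt_iff (x y : V) : OpLt K x y ↔ x < y := Iff.rfl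

@[simp] lemma opMem_iff (x : V) : OpMem K x ↔ x ∈ GroupPair.G K (V := V) := Iff.rfl

end Structure

section

variable {K : Type u} [Field K] [LinearOrder K]

/-- A structure satisfying the hereditary axioms whose predicate is proper is an ordered vector
space with a subgroup. -/
theorem OpAxioms.exists_groupPair {V : Type u} [S : (langG K).Structure V] (h : OpAxioms K V)
    (hp : ∃ x : V, ¬ OpMem K x) :
    ∃ (_ : AddCommGroup V) (_ : LinearOrder V) (_ : IsOrderedAddMonoid V) (_ : Module K V)
      (_ : PosSMulStrictMono K V) (_ : GroupPair K V), S = GroupPair.structure K V := by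
  classical
  let _ : Zero V := ⟨opZero K V⟩
  let _ : Add V := ⟨opAdd K⟩
  let _ : Neg V := ⟨opSMul (-1 : K)⟩
  let iG : AddCommGroup V :=
    { add_assoc := h.add_assoc
      zero_add := fun x => (h.add_comm _ _).trans (h.add_zero x)
      add_zero := h.add_zero
      nsmul := nsmulRec
      zsmul := zsmulRec
      neg_add_cancel := fun x => (h.add_comm _ _).trans (h.add_neg x)
      add_comm := h.add_comm }
  let iO : LinearOrder V :=
    { le := fun x y => x = y ∨ OpLt K x y
      lt := OpLt K
      le_refl := fun x => Or.inl rfl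
      le_trans := by
        rintro x y z (rfl | hxy) (rfl | hyz)
        exacts [Or.inl rfl, Or.inr hyz, Or.inr hxy, Or.inr (h.lt_trans _ _ _ hxy hyz)]
      le_antisymm := by
        rintro x y (rfl | hxy) (h' | hyx)
        exacts [rfl, rfl, h'.symm, (h.lt_irrefl _ (h.lt_trans _ _ _ hxy hyx)).elim]
      lt_iff_le_not_ge := by
        refine fun x y => ⟨fun hxy => ⟨Or.inr hxy, ?_⟩, ?_⟩
        · rintro (rfl | hyx)
          exacts [h.lt_irrefl _ hxy, h.lt_irrefl _ (h.lt_trans _ _ _ hxy hyx)]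
        · rintro ⟨rfl | hxy, h'⟩
          exacts [(h' (Or.inl rfl)).elim, hxy]
      le_total := by
        intro x y
        rcases h.lt_trichotomy x y with hxy | rfl | hxy
        exacts [Or.inl (Or.inr hxy), Or.inl (Or.inl rfl), Or.inr (Or.inr hxy)]
      toDecidableLE := Classical.decRel _ }
  have iA : IsOrderedAddMonoid V :=
    { add_le_add_left := by
        rintro x y (rfl | hxy) z
        exacts [Or.inl rfl, Or.inr (h.add_lt_add _ _ _ hxy)] }
  let iS : SMul K V := ⟨opSMul⟩
  let iM : Module K V := Module.ofMinimalAxioms h.smul_add h.add_smul h.mul_smul h.one_smul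
  have iP : PosSMulStrictMono K V := ⟨fun k hk x y hxy => by
    have := h.smul_pos k hk (y - x) (sub_pos.2 hxy)
    change 0 < k • (y - x) at this
    rwa [smul_sub, sub_pos] at this⟩
  let G : AddSubgroup V :=
    { carrier := {x | OpMem K x}
      zero_mem' := h.zero_mem
      add_mem' := fun {x y} => h.add_mem x y
      neg_mem' := fun {x} => h.neg_mem x }
  let iQ : GroupPair K V :=
    { one := opConst V (1 : K)
      one_pos := h.one_pos
      G := G
      rat_smul_mem := by
        intro q x hx
        have hx' : (q.den : K)⁻¹ • x ∈ G := h.inv_smul_mem q.den q.pos x hx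
        have hq : (q : K) • x = q.num • (q.den : K)⁻¹ • x := by
          rw [← Int.cast_smul_eq_zsmul K, smul_smul, ← div_eq_mul_inv, Rat.cast_def]
        exact hq ▸ G.zsmul_mem hx' _
      exists_notMem := hp }
  refine ⟨iG, iO, iA, iM, iP, iQ, ?_⟩
  ext n f x
  · rcases f with f | f
    · cases f with
      | zero => exact congrArg _ (Subsingleton.elim _ _)
      | const k =>
        exact (congrArg _ (Subsingleton.elim _ _)).trans (h.const_eq k)
      | smul k => exact congrArg _ (by ext i; fin_cases i; rfl)
      | add => exact congrArg _ (by ext i; fin_cases i <;> rfl)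
    · exact nomatch f
  · rcases f with f | f
    · cases f
      exact Eq.to_iff (congrArg _ (by ext i; fin_cases i <;> rfl))
    · cases f
      exact Eq.to_iff (congrArg _ (by ext i; fin_cases i; rfl))

variable {V : Type u} [AddCommGroup V] [LinearOrder V] [IsOrderedAddMonoid V] [Module K V]
  [PosSMulStrictMono K V] [GroupPair K V]

theorem models_theoryG [IsStrictOrderedRing K]
    (hd : ∀ a b : V, a < b → ∃ x ∈ GroupPair.G K (V := V), a < x ∧ x < b)
    (hc : ∀ a b : V, a < b → ∃ x ∉ GroupPair.G K (V := V), a < x ∧ x < b) :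
    V ⊨ theoryG K := by
  have h : V ⊨ theory K := by
    refine ⟨fun φ hφ => ?_⟩
    cases hφ <;> simp [Sentence.Realize, Formula.Realize, Fin.snoc]
    case add_assoc => exact add_assoc
    case add_comm => exact add_comm
    case mul_smul => exact mul_smul _ _
    case add_smul => exact add_smul _ _
    case lt_trans => exact fun a b c => lt_trans
    case lt_trichotomy => exact lt_trichotomy
    case smul_pos hk => exact fun a => smul_pos hk
    case one_pos => exact GroupPair.one_pos
  refine ⟨?_⟩
  rintro φ (hφ | hφ)
  · exact ((LHom.onTheory_model (LHom.sumInl : lang K →ᴸ langG K) _).2 h).realize_of_mem φ hφ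
  · cases hφ <;> simp [Sentence.Realize, Formula.Realize, Fin.snoc]
    case add_mem => exact fun a b => add_mem
    case divisible n hn =>
      intro a ha
      refine ⟨(n : K)⁻¹ • a, ?_, smul_inv_smul₀ (by positivity) a⟩
      simpa using GroupPair.rat_smul_mem (K := K) (n : ℚ)⁻¹ ha
    case dense => exact hd
    case codense => exact hc

end

section Embeddings

variable {K : Type u} [Field K] {V W : Type u} [AddCommGroup V] [LinearOrder V] [Module K V]
  [GroupPair K V] [AddCommGroup W] [LinearOrder W] [Module K W] [GroupPair K W]

/-- An increasing `K`-linear map that respects `1` and the subgroups, as an embedding of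
structures. -/
def embeddingOfLinearMap (f : V →ₗ[K] W) (hf : StrictMono f)
    (h₁ : f (GroupPair.one K) = GroupPair.one K)
    (hG : ∀ x, f x ∈ GroupPair.G K (V := W) ↔ x ∈ GroupPair.G K (V := V)) :
    V ↪[langG K] W where
  toFun := f
  inj' := hf.injective
  map_fun' := by
    rintro n (g | g) x
    · cases g with
      | zero => exact map_zero f
      | const k => exact (map_smul f k _).trans (congrArg _ h₁)
      | smul k => exact map_smul f k _
      | add => exact map_add f _ _
    · exact nomatch g
  map_rel' := by
    rintro n (g | g) x
    · cases g
      exact hf.lt_iff_lt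
    · cases g
      exact hG _

variable (f : V ↪[langG K] W)

/-- The linear map underlying an embedding of structures. -/
def linearMapOfEmbedding : V →ₗ[K] W where
  toFun := f
  map_add' := map_opAdd f
  map_smul' := map_opSMul f

lemma map_lt_iff (x y : V) : f x < f y ↔ x < y := map_opLt f x y

lemma map_mem_iff (x : V) : f x ∈ GroupPair.G K (V := W) ↔ x ∈ GroupPair.G K (V := V) :=
  map_opMem f x

lemma map_one_eq : f (GroupPair.one K) = GroupPair.one K := by
  simpa using map_opConst f (1 : K)

end Embeddings

/-! ### Extensions in which the subgroup is dense and codense -/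

section DenseExtension

variable {K : Type u} [Field K] {V : Type u} [AddCommGroup V] [Module K V]

variable (K V) in
/-- The sum of the coordinates. -/
noncomputable def coordSum : Lex (ℕ →₀ V) →ₗ[K] V :=
  Finsupp.lsum K (fun _ => LinearMap.id) ∘ₗ (ofLexLinearEquiv K (ℕ →₀ V)).toLinearMap

variable (K) in
/-- The vector with `x` in place `i` and zeros elsewhere. -/
noncomputable def lexSingle (i : ℕ) : V →ₗ[K] Lex (ℕ →₀ V) :=
  (toLexLinearEquiv K (ℕ →₀ V)).toLinearMap ∘ₗ Finsupp.lsingle i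

lemma coordSum_lexSingle (i : ℕ) (x : V) : coordSum K V (lexSingle K i x) = x := by
  simp [coordSum, lexSingle]

variable [LinearOrder V]

lemma lexSingle_strictMono (i : ℕ) : StrictMono (lexSingle K (V := V) i) := by
  intro x y hxy
  rw [Finsupp.Lex.lt_iff]
  refine ⟨i, fun j hj => ?_, ?_⟩
  · simp [lexSingle, hj.ne]
  · simpa [lexSingle] using hxy

variable [GroupPair K V]

/-- The subgroup consists of the vectors whose coordinates sum to an element of the subgroup of `V`;
it induces the given subgroup on each copy of `V`. -/
noncomputable instance lexGroupPair : GroupPair K (Lex (ℕ →₀ V)) where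
  one := lexSingle K 0 (GroupPair.one K)
  one_pos := by
    simpa using lexSingle_strictMono (K := K) 0 (GroupPair.one_pos (K := K) (V := V))
  G := (GroupPair.G K (V := V)).comap (coordSum K V).toAddMonoidHom
  rat_smul_mem := by
    intro q x hx
    simpa using GroupPair.rat_smul_mem q hx
  exists_notMem := by
    obtain ⟨x, hx⟩ := GroupPair.exists_notMem (K := K) (V := V)
    exact ⟨lexSingle K 0 x, by simpa [coordSum_lexSingle] using hx⟩

lemma mem_lex_G {x : Lex (ℕ →₀ V)} :
    x ∈ GroupPair.G K (V := Lex (ℕ →₀ V)) ↔ coordSum K V x ∈ GroupPair.G K (V := V) := Iff.rfl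

variable [IsOrderedAddMonoid V]

/-- Every interval contains vectors with any prescribed sum of coordinates: beyond the first place
where the end points differ, the coordinates are free. -/
lemma exists_between_coordSum_eq {a b : Lex (ℕ →₀ V)} (hab : a < b) (t : V) :
    ∃ x, a < x ∧ x < b ∧ coordSum K V x = t := by
  obtain ⟨i, h₁, h₂⟩ := Finsupp.Lex.lt_iff.1 hab
  let o : V := GroupPair.one K
  refine ⟨a + (lexSingle K (i + 1) o + lexSingle K (i + 2) (t - coordSum K V a - o)), ?_, ?_, ?_⟩
  · refine Finsupp.Lex.lt_iff.2 ⟨i + 1, fun j hj => ?_, ?_⟩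
    · have h' : i + 2 ≠ j := by omega
      simp [lexSingle, hj.ne, h']
    · simpa [lexSingle] using GroupPair.one_pos (K := K) (V := V)
  · refine Finsupp.Lex.lt_iff.2 ⟨i, fun j hj => ?_, ?_⟩
    · have h' : i + 1 ≠ j := by omega
      have h'' : i + 2 ≠ j := by omega
      simpa [lexSingle, h', h''] using h₁ j hj
    · simpa [lexSingle] using h₂
  · simp only [map_add, coordSum_lexSingle]
    abel

variable [LinearOrder K] [PosSMulStrictMono K V]

instance lexPosSMulStrictMono : PosSMulStrictMono K (Lex (ℕ →₀ V)) where
  smul_lt_smul_of_pos_left := by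
    intro k hk a b hab
    rw [Finsupp.Lex.lt_iff] at hab ⊢
    obtain ⟨i, h₁, h₂⟩ := hab
    exact ⟨i, fun j hj => congrArg (k • ·) (h₁ j hj), smul_lt_smul_of_pos_left h₂ hk⟩

/-- Every ordered vector space with a proper subgroup, as encoded by `GroupPair`, embeds in a model
of `theoryG K` whose subgroup contains a `K`-line: the subgroup contains all vectors of the form `(x, -x, 0, …)`. -/
theorem exists_embedding_model [IsStrictOrderedRing K] :
    ∃ (W : Type u) (_ : (langG K).Structure W), W ⊨ theoryG K ∧ Nonempty (V ↪[langG K] W) ∧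
      ∃ x : W, OpLt K (opZero K W) x ∧ ∀ k : K, OpMem K (opSMul k x) := by
  refine ⟨Lex (ℕ →₀ V), inferInstance, models_theoryG ?_ ?_,
    ⟨embeddingOfLinearMap (lexSingle K 0) (lexSingle_strictMono 0) rfl fun x => ?_⟩,
    lexSingle K 0 (GroupPair.one K) - lexSingle K 1 (GroupPair.one K), ?_, fun k => ?_⟩
  · intro a b hab
    obtain ⟨x, hax, hxb, hx⟩ := exists_between_coordSum_eq (K := K) hab 0
    exact ⟨x, mem_lex_G.2 (hx ▸ zero_mem _), hax, hxb⟩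
  · intro a b hab
    obtain ⟨y, hy⟩ := GroupPair.exists_notMem (K := K) (V := V)
    obtain ⟨x, hax, hxb, hx⟩ := exists_between_coordSum_eq (K := K) hab y
    exact ⟨x, fun h => hy (hx ▸ mem_lex_G.1 h), hax, hxb⟩
  · rw [mem_lex_G, coordSum_lexSingle]
  · refine sub_pos.2 (Finsupp.Lex.lt_iff.2 ⟨0, fun j hj => absurd hj (Nat.not_lt_zero j), ?_⟩)
    simpa [lexSingle] using GroupPair.one_pos (K := K) (V := V)
  · rw [opSMul_eq, opMem_iff, mem_lex_G, map_smul, map_sub, coordSum_lexSingle,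
      coordSum_lexSingle, sub_self, smul_zero]
    exact zero_mem _

end DenseExtension

/-! ### Amalgamation -/

section Cone

variable {K : Type*} [Field K] [LinearOrder K] [IsStrictOrderedRing K] {P : Type*}
  [AddCommGroup P] [Module K P]

/-- Every salient cone in a vector space is contained in the cone of nonnegative vectors of a
linear order. -/
theorem exists_total_cone_ge (C : PointedCone K P) (hC : ∀ x ∈ C, -x ∈ C → x = 0) :
    ∃ T : PointedCone K P, C ≤ T ∧ (∀ x ∈ T, -x ∈ T → x = 0) ∧ ∀ x, x ∈ T ∨ -x ∈ T := by
  obtain ⟨T, hCT, hT⟩ := zorn_le_nonempty₀ {T : PointedCone K P | ∀ x ∈ T, -x ∈ T → x = 0}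
    (fun c hc hchain y hy => by
      refine ⟨sSup c, fun x hx hx' => ?_, fun z hz => le_sSup hz⟩
      obtain ⟨S, hS, hxS⟩ := (Submodule.mem_sSup_of_directed ⟨y, hy⟩ hchain.directedOn).1 hx
      obtain ⟨S', hS', hxS'⟩ := (Submodule.mem_sSup_of_directed ⟨y, hy⟩ hchain.directedOn).1 hx'
      rcases hchain.total hS hS' with h | h
      · exact hc hS' x (h hxS) hxS'
      · exact hc hS x hxS (h hxS')) C hC
  refine ⟨T, hCT, hT.prop, fun x => ?_⟩
  by_contra! hx
  -- Adjoining `x` to `T` gives a cone that is still salient because `-x ∉ T`.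
  have hmem : x ∈ T ⊔ Submodule.span {c : K // 0 ≤ c} {x} :=
    Submodule.mem_sup_right (Submodule.mem_span_singleton_self x)
  refine hx.1 (hT.le_of_ge ?_ le_sup_left hmem)
  intro y hy hy'
  obtain ⟨a, ha, b, hb, rfl⟩ := Submodule.mem_sup.1 hy
  obtain ⟨a', ha', b', hb', h⟩ := Submodule.mem_sup.1 hy'
  obtain ⟨k, rfl⟩ := Submodule.mem_span_singleton.1 hb
  obtain ⟨k', rfl⟩ := Submodule.mem_span_singleton.1 hb'
  have hsum : -((k + k') • x) = a + a' := by
    rw [add_smul]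
    exact sub_eq_zero.1 (Eq.trans (by abel) (sub_eq_zero.2 h.symm))
  have hk : k + k' = 0 := by
    by_contra hk
    have hpos : 0 < ((k + k' : {c : K // 0 ≤ c}) : K) :=
      lt_of_le_of_ne (k + k').2 fun h0 => hk (Subtype.ext h0.symm)
    refine hx.2 ?_
    have h₁ : -x = ((k + k' : {c : K // 0 ≤ c}) : K)⁻¹ • (a + a') := by
      rw [← hsum]
      change -x = _ • -(((k + k' : {c : K // 0 ≤ c}) : K) • x)
      rw [smul_neg, inv_smul_smul₀ hpos.ne']
    rw [h₁]
    exact T.smul_mem (inv_nonneg.2 hpos.le) (T.add_mem ha ha')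
  have hk₀ : k = 0 := by
    have h0 : (k : K) + k' = 0 := congrArg Subtype.val hk
    exact Subtype.ext (le_antisymm (show (k : K) ≤ 0 by linarith [k'.2]) k.2)
  have hk₀' : k' = 0 := by simpa [hk₀] using hk
  rw [hk, zero_smul, neg_zero] at hsum
  have ha0 : a = 0 := hT.prop a ha (by rwa [neg_eq_of_add_eq_zero_right hsum.symm])
  rw [ha0, hk₀, zero_smul, zero_add]

/-- A salient cone in a vector space consists of nonnegative vectors for some linear order that
makes it an ordered vector space. -/
theorem exists_linearOrder_of_cone (C : PointedCone K P) (hC : ∀ x ∈ C, -x ∈ C → x = 0) :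
    ∃ _ : LinearOrder P, IsOrderedAddMonoid P ∧ PosSMulStrictMono K P ∧ ∀ x ∈ C, 0 ≤ x := by
  classical
  obtain ⟨T, hCT, hT, htot⟩ := exists_total_cone_ge C hC
  let A : AddGroupCone P :=
    { T.toAddSubmonoid with eq_zero_of_mem_of_neg_mem' := fun {x} => hT x }
  have hA : HasMemOrNegMem A := ⟨htot⟩
  let iO : LinearOrder P := LinearOrder.mkOfAddGroupCone A
  have iA : IsOrderedAddMonoid P := IsOrderedAddMonoid.mkOfCone A
  have hle (x : P) : 0 ≤ x ↔ x ∈ T := by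
    change x - 0 ∈ T ↔ _
    rw [sub_zero]
  refine ⟨iO, iA, ⟨fun k hk x y hxy => ?_⟩, fun x hx => (hle x).2 (hCT hx)⟩
  have h : 0 ≤ k • (y - x) :=
    (hle _).2 (T.smul_mem hk.le ((hle _).1 (sub_nonneg.2 hxy.le)))
  rw [smul_sub, sub_nonneg] at h
  exact lt_of_le_of_ne h fun h' => hxy.ne (smul_right_injective P hk.ne' h')

end Cone

section Amalgam

variable {K : Type u} [Field K] [LinearOrder K] [IsStrictOrderedRing K]
  {V : Type u} [AddCommGroup V] [LinearOrder V] [IsOrderedAddMonoid V] [Module K V]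
  [PosSMulStrictMono K V] [GroupPair K V]
  {W : Type u} [AddCommGroup W] [LinearOrder W] [IsOrderedAddMonoid W] [Module K W]
  [PosSMulStrictMono K W] [GroupPair K W]

variable (K V W) in
/-- A partial isomorphism between `V` and `W`: the graph `D` of an isomorphism between subspaces
of `V` and `W` that contain `1`, respecting `1`, the order and the subgroups. -/
structure IsPartialIso (D : Submodule K (V × W)) : Prop where
  one_mem : (GroupPair.one K, GroupPair.one K) ∈ D
  pos_iff : ∀ p ∈ D, 0 < p.1 ↔ 0 < p.2
  mem_iff : ∀ p ∈ D, p.1 ∈ GroupPair.G K (V := V) ↔ p.2 ∈ GroupPair.G K (V := W)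

/-- The amalgam of `V` and `W` over a partial isomorphism `D`, in which the intersection of `V`
and `W` is no larger than prescribed by `D`. -/
theorem IsPartialIso.exists_amalgam {D : Submodule K (V × W)} (hD : IsPartialIso K V W D) :
    ∃ (P : Type u) (_ : AddCommGroup P) (_ : LinearOrder P) (_ : IsOrderedAddMonoid P)
      (_ : Module K P) (_ : PosSMulStrictMono K P) (_ : GroupPair K P)
      (i : V ↪[langG K] P) (j : W ↪[langG K] P), ∀ x y, i x = j y ↔ (x, y) ∈ D := by
  let P := (V × W) ⧸ D
  let i : V →ₗ[K] P := D.mkQ ∘ₗ LinearMap.inl K V W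
  -- The sign makes `(x, y) ∈ D` equivalent to `i x = j y` rather than `i x = -j y`.
  let j : W →ₗ[K] P := -(D.mkQ ∘ₗ LinearMap.inr K V W)
  have hij (x : V) (y : W) : i x = j y ↔ (x, y) ∈ D := by
    rw [← sub_eq_zero]
    change D.mkQ (x, 0) - -D.mkQ (0, y) = 0 ↔ _
    rw [sub_neg_eq_add, ← map_add, Prod.mk_add_mk, add_zero, zero_add, Submodule.mkQ_apply,
      Submodule.Quotient.mk_eq_zero]
  have hneg (x : V) (y : W) (h : (x, y) ∈ D) : x < 0 ↔ y < 0 := by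
    simpa using hD.pos_iff _ (D.neg_mem h)
  -- The sums of nonnegative vectors of `V` and of `W` form a salient cone.
  let C : PointedCone K P :=
    { carrier := {p | ∃ x y, 0 ≤ x ∧ 0 ≤ y ∧ i x + j y = p}
      zero_mem' := ⟨0, 0, le_rfl, le_rfl, by simp⟩
      add_mem' := by
        rintro _ _ ⟨x, y, hx, hy, rfl⟩ ⟨x', y', hx', hy', rfl⟩
        refine ⟨x + x', y + y', add_nonneg hx hx', add_nonneg hy hy', ?_⟩
        rw [map_add, map_add]
        abel
      smul_mem' := by
        rintro ⟨k, hk⟩ _ ⟨x, y, hx, hy, rfl⟩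
        refine ⟨k • x, k • y, smul_nonneg hk hx, smul_nonneg hk hy, ?_⟩
        rw [map_smul, map_smul, ← smul_add]
        rfl }
  have hC : ∀ p ∈ C, -p ∈ C → p = 0 := by
    rintro _ ⟨x, y, hx, hy, rfl⟩ ⟨x', y', hx', hy', h⟩
    have h₁ : (x + x', -(y + y')) ∈ D := by
      rw [← hij, map_neg, map_add, map_add]
      exact sub_eq_zero.1 (Eq.trans (by abel) (sub_eq_zero.2 h))
    have h₂ : x + x' = 0 := by
      refine ((add_nonneg hx hx').eq_or_lt.resolve_right fun h' => ?_).symm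
      have := (hD.pos_iff _ h₁).1 h'
      exact (neg_pos.1 this).not_ge (add_nonneg hy hy')
    have h₃ : y + y' = 0 := by
      refine ((add_nonneg hy hy').eq_or_lt.resolve_right fun h' => ?_).symm
      exact ((hneg _ _ h₁).2 (neg_lt_zero.2 h')).ne h₂
    rw [((add_eq_zero_iff_of_nonneg hx hx').1 h₂).1, ((add_eq_zero_iff_of_nonneg hy hy').1 h₃).1,
      map_zero, map_zero, add_zero]
  obtain ⟨iO, iA, iS, hpos⟩ := exists_linearOrder_of_cone C hC
  have hi : Function.Injective i := by
    refine (injective_iff_map_eq_zero i).2 fun x hx => ?_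
    have h : (x, (0 : W)) ∈ D := (hij x 0).1 (by rw [hx, map_zero])
    have h₁ := hD.pos_iff _ h
    have h₂ := hneg _ _ h
    simp only [lt_irrefl, iff_false, not_lt] at h₁ h₂
    exact le_antisymm h₁ h₂
  have hj : Function.Injective j := by
    refine (injective_iff_map_eq_zero j).2 fun y hy => ?_
    have h : ((0 : V), y) ∈ D := (hij 0 y).1 (by rw [hy, map_zero])
    have h₁ := hD.pos_iff _ h
    have h₂ := hneg _ _ h
    simp only [lt_irrefl, false_iff, not_lt] at h₁ h₂
    exact le_antisymm h₁ h₂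
  have hi' : StrictMono i := by
    refine Monotone.strictMono_of_injective (fun x y hxy => ?_) hi
    rw [← sub_nonneg, ← map_sub]
    exact hpos _ ⟨y - x, 0, sub_nonneg.2 hxy, le_rfl, by rw [map_zero, add_zero]⟩
  have hj' : StrictMono j := by
    refine Monotone.strictMono_of_injective (fun x y hxy => ?_) hj
    rw [← sub_nonneg, ← map_sub]
    exact hpos _ ⟨0, y - x, le_rfl, sub_nonneg.2 hxy, by rw [map_zero, zero_add]⟩
  have hone : i (GroupPair.one K) = j (GroupPair.one K) := (hij _ _).2 hD.one_mem
  let G : AddSubgroup P :=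
    (GroupPair.G K (V := V)).map i.toAddMonoidHom ⊔ (GroupPair.G K (V := W)).map j.toAddMonoidHom
  have hG (p : P) : p ∈ G ↔
      ∃ x ∈ GroupPair.G K (V := V), ∃ y ∈ GroupPair.G K (V := W), i x + j y = p := by
    simp [G, AddSubgroup.mem_sup]
  have hiG (x : V) : i x ∈ G ↔ x ∈ GroupPair.G K (V := V) := by
    refine ⟨fun h => ?_, fun h => (hG _).2 ⟨x, h, 0, zero_mem _, by simp⟩⟩
    obtain ⟨x', hx', y, hy, h⟩ := (hG _).1 h
    have h₁ : (x - x', y) ∈ D := by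
      rw [← hij, map_sub]
      exact sub_eq_zero.1 (Eq.trans (by abel) (sub_eq_zero.2 h.symm))
    simpa using add_mem ((hD.mem_iff _ h₁).2 hy) hx'
  have hjG (y : W) : j y ∈ G ↔ y ∈ GroupPair.G K (V := W) := by
    refine ⟨fun h => ?_, fun h => (hG _).2 ⟨0, zero_mem _, y, h, by simp⟩⟩
    obtain ⟨x, hx, y', hy', h⟩ := (hG _).1 h
    have h₁ : (x, y - y') ∈ D := by
      rw [← hij, map_sub]
      exact sub_eq_zero.1 (Eq.trans (by abel) (sub_eq_zero.2 h))
    simpa using add_mem ((hD.mem_iff _ h₁).1 hx) hy'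
  let iQ : GroupPair K P :=
    { one := i (GroupPair.one K)
      one_pos := by simpa using hi' (GroupPair.one_pos (K := K) (V := V))
      G := G
      rat_smul_mem := by
        intro q p hp
        obtain ⟨x, hx, y, hy, rfl⟩ := (hG _).1 hp
        refine (hG _).2 ⟨(q : K) • x, GroupPair.rat_smul_mem q hx, (q : K) • y,
          GroupPair.rat_smul_mem q hy, ?_⟩
        rw [map_smul, map_smul, smul_add]
      exists_notMem := by
        obtain ⟨x, hx⟩ := GroupPair.exists_notMem (K := K) (V := V)
        exact ⟨i x, fun h => hx ((hiG x).1 h)⟩ }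
  exact ⟨P, inferInstance, iO, iA, inferInstance, iS, iQ,
    embeddingOfLinearMap i hi' rfl hiG, embeddingOfLinearMap j hj' hone.symm hjG, hij⟩

end Amalgam

/-! ### Consequences of model completeness -/

section ModelCompanion

variable {K : Type u} {T : (langG K).Theory}

theorem exists_elementaryEmbedding_eq (hT : IsModelComplete T) {V W : Type u}
    [(langG K).Structure V] [(langG K).Structure W] (hV : V ⊨ T) (hW : W ⊨ T)
    (f : V ↪[langG K] W) : ∃ g : V ↪ₑ[langG K] W, ∀ x, g x = f x := by
  have : Nonempty V := ⟨opZero K V⟩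
  have : Nonempty W := ⟨opZero K W⟩
  exact ⟨⟨f, fun n φ a => hT (Theory.ModelType.of T V) (Theory.ModelType.of T W) f n φ a⟩,
    fun _ => rfl⟩

variable [Field K] [LinearOrder K]

theorem exists_embedding_companion (hT : IsModelCompanion (theoryG K) T) {V : Type u}
    [(langG K).Structure V] (hV : V ⊨ theoryG K) :
    ∃ (N : Type u) (_ : (langG K).Structure N), N ⊨ T ∧ Nonempty (V ↪[langG K] N) := by
  have : Nonempty V := ⟨opZero K V⟩
  obtain ⟨N, hN⟩ := hT.embeds (Theory.ModelType.of _ V)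
  exact ⟨N, inferInstance, N.is_model, hN⟩

theorem exists_embedding_theoryG (hT : IsModelCompanion (theoryG K) T) {V : Type u}
    [(langG K).Structure V] (hV : V ⊨ T) :
    ∃ (M : Type u) (_ : (langG K).Structure M), M ⊨ theoryG K ∧ Nonempty (V ↪[langG K] M) := by
  have : Nonempty V := ⟨opZero K V⟩
  obtain ⟨M, hM⟩ := hT.embeds' (Theory.ModelType.of _ V)
  exact ⟨M, inferInstance, M.is_model, hM⟩

variable [IsStrictOrderedRing K]

/-- Every model of the model companion is an ordered vector space with a proper subgroup. -/
theorem exists_groupPair_of_model (hT : IsModelCompanion (theoryG K) T) {V : Type u}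
    [S : (langG K).Structure V] (hV : V ⊨ T) :
    ∃ (_ : AddCommGroup V) (_ : LinearOrder V) (_ : IsOrderedAddMonoid V) (_ : Module K V)
      (_ : PosSMulStrictMono K V) (_ : GroupPair K V), S = GroupPair.structure K V := by
  obtain ⟨M, _, hM, ⟨f⟩⟩ := exists_embedding_theoryG hT hV
  obtain ⟨N, _, hN, ⟨g⟩⟩ := exists_embedding_companion hT hM
  refine (OpAxioms.of_embedding f (.of_model hM)).exists_groupPair ?_
  -- A nonmember of the subgroup exists in `M`, hence in `N`, hence in `V`, which is elementary
  -- in `N`.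
  obtain ⟨x, hx⟩ : ∃ x : M, ¬ OpMem K x := by
    have h := hM.realize_of_mem _ (Or.inr GAx.codense)
    simp only [Sentence.Realize, Formula.Realize, BoundedFormula.realize_all,
      BoundedFormula.realize_imp, BoundedFormula.realize_ex, BoundedFormula.realize_inf,
      BoundedFormula.realize_not, realize_fmem, LHom.realize_onBoundedFormula,
      realize_flt] at h
    obtain ⟨x, hx, -⟩ := h _ _ (OpAxioms.of_model hM).one_pos
    exact ⟨_, hx⟩
  let φ : (langG K).Sentence := ∃' ∼(fmem (&0))
  have hφ {U : Type u} [(langG K).Structure U] : U ⊨ φ ↔ ∃ x : U, ¬ OpMem K x := by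
    simp [φ, Sentence.Realize, Formula.Realize, Fin.snoc]
  obtain ⟨e, -⟩ := exists_elementaryEmbedding_eq hT.modelComplete hV hN (g.comp f)
  exact hφ.1 ((e.map_sentence φ).2 (hφ.2 ⟨g x, fun h => hx ((map_opMem g x).1 h)⟩))

section

variable {V : Type u} [AddCommGroup V] [LinearOrder V] [IsOrderedAddMonoid V] [Module K V]
  [PosSMulStrictMono K V] [GroupPair K V]

/-- If `K` is finite-dimensional over `ℚ`, then in every model of the model companion some
`K`-line is contained in the subgroup. -/
theorem exists_line_subset_G (hT : IsModelCompanion (theoryG K) T)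
    [FiniteDimensional ℚ K] (hV : V ⊨ T) :
    ∃ x : V, 0 < x ∧ ∀ k : K, k • x ∈ GroupPair.G K (V := V) := by
  obtain ⟨W, _, hW, ⟨f⟩, x, hx₀, hx⟩ := exists_embedding_model (K := K) (V := V)
  obtain ⟨N, _, hN, ⟨g⟩⟩ := exists_embedding_companion hT hW
  let b := Module.finBasis ℚ K
  let φ : (langG K).Sentence :=
    ∃' (LHom.sumInl.onBoundedFormula (flt tzero (&0)) ⊓
      BoundedFormula.iInf fun i => fmem (tsmul (b i) (&0)))
  have hφ {U : Type u} [(langG K).Structure U] :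
      U ⊨ φ ↔ ∃ x : U, OpLt K (opZero K U) x ∧ ∀ i, OpMem K (opSMul (b i) x) := by
    simp [φ, Sentence.Realize, Formula.Realize, Fin.snoc]
  obtain ⟨e, -⟩ := exists_elementaryEmbedding_eq hT.modelComplete hV hN (g.comp f)
  obtain ⟨y, hy₀, hy⟩ := hφ.1 ((e.map_sentence φ).2 (hφ.2 ⟨g x, by
    rwa [← map_opZero g, map_opLt], fun i => by
    rw [← map_opSMul, map_opMem]
    exact hx _⟩))
  refine ⟨y, hy₀, fun k => ?_⟩
  have hk : k ∈ Submodule.span ℚ (Set.range b) := b.span_eq ▸ Submodule.mem_top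
  induction hk using Submodule.span_induction with
  | mem k hk =>
    obtain ⟨i, rfl⟩ := hk
    exact hy i
  | zero => simp
  | add k l _ _ hk hl => simpa [add_smul] using add_mem hk hl
  | smul q k _ hk =>
    rw [Rat.smul_def, mul_smul]
    exact GroupPair.rat_smul_mem q hk

variable {W : Type u} [AddCommGroup W] [LinearOrder W] [IsOrderedAddMonoid W] [Module K W]
  [PosSMulStrictMono K W] [GroupPair K W]

/-- Two models of the model companion have a common elementary extension amalgamating a given
partial isomorphism. -/
theorem IsPartialIso.exists_elementary_amalgam (hT : IsModelCompanion (theoryG K) T)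
    (hV : V ⊨ T) (hW : W ⊨ T) {D : Submodule K (V × W)} (hD : IsPartialIso K V W D) :
    ∃ (Q : Type u) (_ : (langG K).Structure Q) (i : V ↪ₑ[langG K] Q) (j : W ↪ₑ[langG K] Q),
      ∀ x y, i x = j y ↔ (x, y) ∈ D := by
  obtain ⟨P, _, _, _, _, _, _, i, j, hij⟩ := hD.exists_amalgam
  obtain ⟨M, _, hM, ⟨f⟩, -⟩ := exists_embedding_model (K := K) (V := P)
  obtain ⟨N, _, hN, ⟨g⟩⟩ := exists_embedding_companion hT hM
  obtain ⟨i', hi'⟩ :=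
    exists_elementaryEmbedding_eq hT.modelComplete hV hN (g.comp (f.comp i))
  obtain ⟨j', hj'⟩ :=
    exists_elementaryEmbedding_eq hT.modelComplete hW hN (g.comp (f.comp j))
  refine ⟨N, inferInstance, i', j', fun x y => ?_⟩
  rw [hi', hj', ← hij x y]
  exact (g.injective.comp f.injective).eq_iff

end

end ModelCompanion

/-! ### Algebraic closure -/

section AlgebraicClosure

variable {K : Type u} [Field K] {V : Type u} [AddCommGroup V] [LinearOrder V] [Module K V]
  [GroupPair K V]

variable (K) in
/-- The `K`-linear span of `C` and of the element `1`. -/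
def linSpan (C : Set V) : Submodule K V := Submodule.span K (insert (GroupPair.one K) C)

lemma subset_linSpan (C : Set V) : C ⊆ linSpan K C :=
  (Set.subset_insert _ _).trans Submodule.subset_span

lemma one_mem_linSpan (C : Set V) : GroupPair.one K ∈ linSpan K C :=
  Submodule.subset_span (Set.mem_insert _ _)

theorem spanSet_eq_linSpan (C : Set V) : spanSet K C = linSpan K C := by
  apply Set.Subset.antisymm
  · intro x hx
    refine Substructure.closure_induction (L := langG K) (p := (· ∈ linSpan K C)) hx
      (fun x hx => subset_linSpan C hx) ?_
    rintro n (f | f) x hx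
    · cases f with
      | zero => exact (linSpan K C).zero_mem
      | const k => exact (linSpan K C).smul_mem k (one_mem_linSpan C)
      | smul k => exact (linSpan K C).smul_mem k (hx 0)
      | add => exact (linSpan K C).add_mem (hx 0) (hx 1)
    · exact nomatch f
  · let S : Substructure (langG K) V := Substructure.closure (langG K) C
    intro x hx
    change x ∈ S
    have hadd (x y : V) (hx : x ∈ S) (hy : y ∈ S) : x + y ∈ S :=
      S.fun_mem (Sum.inl Func.add) ![x, y] (by simp [hx, hy, Fin.forall_fin_two])
    have hsmul (k : K) (x : V) (hx : x ∈ S) : k • x ∈ S :=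
      S.fun_mem (Sum.inl (Func.smul k)) ![x] (by simp [hx])
    induction hx using Submodule.span_induction with
    | mem x hx =>
      rcases hx with rfl | hx
      · have := S.fun_mem (Sum.inl (Func.const (1 : K))) ![] (by simp)
        rwa [← one_smul K (GroupPair.one K)]
      · exact Substructure.subset_closure hx
    | zero => exact S.fun_mem (Sum.inl Func.zero) ![] (by simp)
    | add x y _ _ hx hy => exact hadd x y hx hy
    | smul k x _ hx => exact hsmul k x hx

theorem spanSet_subset_acl (C : Set V) : spanSet K C ⊆ acl (langG K) C := by
  intro b hb
  obtain ⟨t, rfl⟩ := Substructure.mem_closure_iff_exists_term.1 hb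
  refine ⟨{t.realize ((↑) : C → V)}, Set.finite_singleton _, ?_, rfl⟩
  refine Set.definable_iff_exists_formula_sum.2
    ⟨Term.equal (Term.var (Sum.inr 0)) (t.relabel Sum.inl), ?_⟩
  ext x
  simp [Formula.realize_equal, Function.comp_def]

lemma isPartialIso_diagonal (A : Submodule K V) (hA : GroupPair.one K ∈ A) :
    IsPartialIso K V V (A.map (LinearMap.prod LinearMap.id LinearMap.id)) where
  one_mem := ⟨_, hA, rfl⟩
  pos_iff := by
    rintro _ ⟨x, -, rfl⟩
    rfl
  mem_iff := by
    rintro _ ⟨x, -, rfl⟩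
    rfl

variable [LinearOrder K] [IsStrictOrderedRing K] [IsOrderedAddMonoid V] [PosSMulStrictMono K V]
  {T : (langG K).Theory}

/-- In the amalgam of two copies of a model over the span of `C`, an element outside the span has
two distinct images, and a finite set definable over `C` has no room for the second one. -/
theorem acl_subset_spanSet (hT : IsModelCompanion (theoryG K) T) (hV : V ⊨ T) (C : Set V) :
    acl (langG K) C ⊆ spanSet K C := by
  rintro b ⟨S, hS, hdef, hb⟩
  obtain ⟨φ, hφ⟩ := Set.definable_iff_exists_formula_sum.1 hdef
  replace hφ (x : V) : x ∈ S ↔ φ.Realize (Sum.elim (↑) fun _ => x) :=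
    Set.ext_iff.1 hφ fun _ => x
  rw [spanSet_eq_linSpan]
  obtain ⟨Q, _, i, j, hij⟩ :=
    (isPartialIso_diagonal (linSpan K C) (one_mem_linSpan C)).exists_elementary_amalgam hT hV hV
  replace hij (x y : V) : i x = j y ↔ x = y ∧ x ∈ linSpan K C := by
    rw [hij]
    constructor
    · rintro ⟨z, hz, h⟩
      obtain ⟨rfl, rfl⟩ := Prod.mk.inj h
      exact ⟨rfl, hz⟩
    · rintro ⟨rfl, hx⟩
      exact ⟨x, hx, rfl⟩
  have := hS.to_subtype
  -- All solutions of `φ` lie in `S`; this statement passes to the elementary extension `i`.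
  let ψ : (langG K).Formula V := Formula.iAlls (Fin 1)
    ((φ.relabel (Sum.map (↑) id) : (langG K).Formula (V ⊕ Fin 1)).imp
      (Formula.iSup fun s : S => Term.equal (Term.var (Sum.inr 0)) (Term.var (Sum.inl (s : V)))))
  have hψ {U : Type u} [(langG K).Structure U] (v : V → U) : ψ.Realize v ↔
      ∀ y : Fin 1 → U, φ.Realize (Sum.elim (fun c : C => v c) y) → ∃ s : S, y 0 = v s := by
    simp only [ψ, Formula.realize_iAlls, Formula.realize_imp, Formula.realize_relabel,
      Formula.realize_iSup, Formula.realize_equal, Term.realize_var, Sum.elim_inl, Sum.elim_inr]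
    refine forall_congr' fun y => imp_congr (Eq.to_iff (congrArg _ ?_)) Iff.rfl
    ext (c | k) <;> rfl
  have h₁ : ψ.Realize (i ∘ id) := by
    refine (i.map_formula ψ id).2 ((hψ id).2 fun y hy => ⟨⟨y 0, (hφ _).2 ?_⟩, rfl⟩)
    convert hy using 1
    ext (c | k)
    · rfl
    · exact congrArg y (Subsingleton.elim 0 k)
  obtain ⟨s, hs⟩ := (hψ _).1 h₁ (fun _ => j b) (by
    have h₂ := (j.map_formula φ _).2 ((hφ b).1 hb)
    convert h₂ using 1
    ext (c | k)
    · exact (hij c c).2 ⟨rfl, subset_linSpan C c.2⟩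
    · rfl)
  obtain ⟨rfl, h⟩ := (hij s b).1 hs.symm
  exact h

theorem acl_eq_spanSet (hT : IsModelCompanion (theoryG K) T) (hV : V ⊨ T) (C : Set V) :
    acl (langG K) C = spanSet K C :=
  (acl_subset_spanSet hT hV C).antisymm (spanSet_subset_acl C)

end AlgebraicClosure

/-! ### Types -/

section Types

variable {K : Type u} [Field K]
  {V : Type u} [AddCommGroup V] [LinearOrder V] [Module K V] [GroupPair K V]
  {W : Type u} [AddCommGroup W] [LinearOrder W] [Module K W] [GroupPair K W]

section Holds

variable {M : Type u} (f : M → W) (s : W)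

lemma holds_belowFormula (b : M) : (belowFormula K b).Holds f s ↔ f b < s :=
  LHom.realize_onFormula _ _

lemma holds_aboveFormula (b : M) : (aboveFormula K b).Holds f s ↔ s < f b :=
  LHom.realize_onFormula _ _

lemma holds_eqFormula (b : M) : (eqFormula K b).Holds f s ↔ s = f b :=
  (LHom.realize_onFormula _ _).trans (BoundedFormula.realize_bdEqual _ _)

/-- The value of the linear combination `v₁ c₁ + ⋯ + vₘ cₘ + k`. -/
def linComb (k : K) (l : List (K × W)) : W :=
  (l.map fun p => p.1 • p.2).sum + k • GroupPair.one K

lemma realize_tlin {α : Type*} (k : K) (l : List (K × α)) (v : α → W) :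
    (tlin k l).realize v = linComb k (l.map fun p => (p.1, v p.2)) := by
  induction l with
  | nil => simp [tlin, linComb]
  | cons p l ih =>
    have : tlin k (p :: l) = tadd (tsmul p.1 (Term.var p.2)) (tlin k l) := rfl
    simp [this, ih, linComb, add_assoc]

lemma holds_cosetFormula (u k : K) (l : List (K × M)) :
    (cosetFormula u k l).Holds f s ↔
      u • s - linComb k (l.map fun p => (p.1, f p.2)) ∈ GroupPair.G K (V := W) := by
  rw [ParamFormula.Holds, Formula.Realize, cosetFormula, realize_fmem, opMem_iff]
  simp only [realize_tadd, realize_tsmul, realize_tlin, opAdd_eq, opSMul_eq, neg_smul, one_smul,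
    List.map_map, ← sub_eq_add_neg]
  rfl

end Holds

lemma exists_eq_linComb {C : Set V} {b : V} (hb : b ∈ linSpan K C) :
    ∃ (k : K) (l : List (K × V)), (∀ p ∈ l, p.2 ∈ C) ∧ b = linComb k l := by
  induction hb using Submodule.span_induction with
  | mem x hx =>
    rcases hx with rfl | hx
    · exact ⟨1, [], by simp, by simp [linComb]⟩
    · exact ⟨0, [(1, x)], by simpa using hx, by simp [linComb]⟩
  | zero => exact ⟨0, [], by simp, by simp [linComb]⟩
  | add x y _ _ hx hy =>
    obtain ⟨k, l, hl, rfl⟩ := hx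
    obtain ⟨k', l', hl', rfl⟩ := hy
    refine ⟨k + k', l ++ l', fun p hp => ?_, ?_⟩
    · exact (List.mem_append.1 hp).elim (hl p) (hl' p)
    · simp only [linComb, List.map_append, List.sum_append, add_smul]
      abel
  | smul a x _ hx =>
    obtain ⟨k, l, hl, rfl⟩ := hx
    refine ⟨a * k, l.map fun p => (a * p.1, p.2), ?_, ?_⟩
    · simp only [List.mem_map]
      rintro _ ⟨p, hp, rfl⟩
      exact hl p hp
    · simp only [linComb, smul_add, List.smul_sum, List.map_map, mul_smul, Function.comp_def]

lemma map_linComb (f : V ↪ₑ[langG K] W) (k : K) (l : List (K × V)) :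
    f (linComb k l) = linComb k (l.map fun p => (p.1, f p.2)) := by
  let g : V →ₗ[K] W := linearMapOfEmbedding f.toEmbedding
  have hg : g (GroupPair.one K) = GroupPair.one K := map_one_eq f.toEmbedding
  change g (linComb k l) = _
  simp only [linComb, map_add, map_smul, hg, map_list_sum, List.map_map]
  congr 3
  ext p
  exact map_smul g p.1 p.2

variable {r : V} {s : W} {f : V ↪ₑ[langG K] W}

/-- An element that realizes the coset type of `r` over `C` lies in the same cosets of the subgroup
as `r`. -/
lemma mem_G_iff_of_cosetType {C : Set V} (h : ∀ φ ∈ cosetType K r C, φ.Holds f s) (u : K) {b : V}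
    (hb : b ∈ linSpan K C) :
    u • r - b ∈ GroupPair.G K (V := V) ↔ u • s - f b ∈ GroupPair.G K (V := W) := by
  obtain ⟨k, l, hl, rfl⟩ := exists_eq_linComb hb
  have h₁ := holds_cosetFormula (id : V → V) r u k l
  have h₂ := holds_cosetFormula f s u k l
  simp only [id, Prod.mk.eta, List.map_id'] at h₁
  rw [map_linComb, ← h₁, ← h₂]
  by_cases hr : (cosetFormula u k l).Holds id r
  · exact iff_of_true hr (h _ ⟨hr, u, k, l, hl, Or.inl rfl⟩)
  · exact iff_of_false hr (h (cosetFormula u k l).not ⟨hr, u, k, l, hl, Or.inr rfl⟩)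

/-- If each multiple `u r` lies in the coset of some element `b` while `u s` lies in the coset of
`f b`, then `r` and `s` agree on membership in all cosets. -/
lemma mem_G_iff_of_forall_exists
    (h : ∀ u : K, ∃ b : V, u • r - b ∈ GroupPair.G K (V := V) ∧
      u • s - f b ∈ GroupPair.G K (V := W)) (u : K) (b : V) :
    u • r - b ∈ GroupPair.G K (V := V) ↔ u • s - f b ∈ GroupPair.G K (V := W) := by
  obtain ⟨c, hr, hs⟩ := h u
  have hf : f (c - b) = f c - f b := map_sub (linearMapOfEmbedding f.toEmbedding) c b
  rw [← sub_add_sub_cancel (u • r) c b, ← sub_add_sub_cancel (u • s) (f c) (f b),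
    AddSubgroup.add_mem_cancel_left _ hr, AddSubgroup.add_mem_cancel_left _ hs, ← hf]
  exact (map_mem_iff f.toEmbedding _).symm

/-- It suffices to know the cosets of the multiples of `r` by scalars that span `K` over `ℚ`. -/
lemma exists_coset_of_span_eq_top [CharZero K] {ι : Type*} {η : ι → K}
    (hη : Submodule.span ℚ (Set.range η) = ⊤)
    {d : ι → V} (hr : ∀ i, η i • r - d i ∈ GroupPair.G K (V := V))
    (hs : ∀ i, η i • s - f (d i) ∈ GroupPair.G K (V := W)) (u : K) :
    ∃ b : V, u • r - b ∈ GroupPair.G K (V := V) ∧ u • s - f b ∈ GroupPair.G K (V := W) := by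
  let g : V →ₗ[K] W := linearMapOfEmbedding f.toEmbedding
  change ∃ b, _ ∧ u • s - g b ∈ _
  have hu : u ∈ Submodule.span ℚ (Set.range η) := hη ▸ Submodule.mem_top
  induction hu using Submodule.span_induction with
  | mem u hu =>
    obtain ⟨i, rfl⟩ := hu
    exact ⟨d i, hr i, hs i⟩
  | zero => exact ⟨0, by simp, by simp⟩
  | add u v _ _ hu hv =>
    obtain ⟨b, hb, hb'⟩ := hu
    obtain ⟨c, hc, hc'⟩ := hv
    refine ⟨b + c, ?_, ?_⟩
    · rw [add_smul, add_sub_add_comm]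
      exact add_mem hb hc
    · rw [add_smul, map_add, add_sub_add_comm]
      exact add_mem hb' hc'
  | smul q u _ hu =>
    obtain ⟨b, hb, hb'⟩ := hu
    refine ⟨(q : K) • b, ?_, ?_⟩
    · rw [Rat.smul_def, mul_smul, ← smul_sub]
      exact GroupPair.rat_smul_mem q hb
    · rw [Rat.smul_def, mul_smul, map_smul, ← smul_sub]
      exact GroupPair.rat_smul_mem q hb'

variable [LinearOrder K] [IsStrictOrderedRing K] [IsOrderedAddMonoid V] [PosSMulStrictMono K V]
  [IsOrderedAddMonoid W] [PosSMulStrictMono K W]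

/-- If `s` realizes the cut of `r` over a subspace `A` and lies in the corresponding cosets of the
subgroup, then the map that extends `f` on `A` and sends `r` to `s` is a partial isomorphism. -/
theorem isPartialIso_adjoin {A : Submodule K V} (hA : GroupPair.one K ∈ A)
    (hlt : ∀ b ∈ A, b < r ↔ f b < s) (hgt : ∀ b ∈ A, r < b ↔ s < f b)
    (hG : ∀ u : K, ∀ b ∈ A, u • r - b ∈ GroupPair.G K (V := V) ↔
      u • s - f b ∈ GroupPair.G K (V := W)) :
    IsPartialIso K V W
      (A.map (LinearMap.prod LinearMap.id (linearMapOfEmbedding f.toEmbedding)) ⊔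
        Submodule.span K {(r, s)}) := by
  let g : V →ₗ[K] W := linearMapOfEmbedding f.toEmbedding
  have hg (x : V) : f x = g x := rfl
  have hmem {p : V × W} (hp : p ∈ A.map (LinearMap.prod LinearMap.id g) ⊔
      Submodule.span K {(r, s)}) : ∃ b ∈ A, ∃ u : K, p = (u • r - b, u • s - g b) := by
    obtain ⟨_, ⟨b, hb, rfl⟩, _, hu, rfl⟩ := Submodule.mem_sup.1 hp
    obtain ⟨u, rfl⟩ := Submodule.mem_span_singleton.1 hu
    refine ⟨-b, neg_mem hb, u, ?_⟩
    simp [add_comm]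
  refine ⟨Submodule.mem_sup_left ⟨_, hA, ?_⟩, fun p hp => ?_, fun p hp => ?_⟩
  · exact Prod.ext rfl (map_one_eq f.toEmbedding)
  · obtain ⟨b, hb, u, rfl⟩ := hmem hp
    have hb' : u⁻¹ • b ∈ A := A.smul_mem _ hb
    rcases lt_trichotomy u 0 with hu | rfl | hu
    · have h := hgt _ hb'
      rw [hg, map_smul, ← sub_neg, ← sub_neg (b := u⁻¹ • g b),
        ← smul_pos_iff_of_neg_left hu, ← smul_pos_iff_of_neg_left (b := s - _) hu] at h
      simpa only [smul_sub, smul_inv_smul₀ hu.ne] using h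
    · have h := map_lt_iff f.toEmbedding 0 (-b)
      change g 0 < g (-b) ↔ _ at h
      rw [map_zero, map_neg] at h
      simpa using h.symm
    · have h := hlt _ hb'
      rw [hg, map_smul, ← sub_pos, ← sub_pos (b := u⁻¹ • g b),
        ← smul_pos_iff_of_pos_left hu, ← smul_pos_iff_of_pos_left (b := s - _) hu] at h
      simpa only [smul_sub, smul_inv_smul₀ hu.ne'] using h
  · obtain ⟨b, hb, u, rfl⟩ := hmem hp
    exact hG u b hb

/-- The cut over the span of `C` and the cosets of the subgroup determine the type over `C`. -/
theorem holds_of_mem_tp {T : (langG K).Theory} (hT : IsModelCompanion (theoryG K) T)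
    (hV : V ⊨ T) (hW : W ⊨ T)
    {C : Set V} (hcut : ∀ φ ∈ cut K r (spanSet K C), φ.Holds f s)
    (hG : ∀ u : K, ∀ b ∈ linSpan K C, u • r - b ∈ GroupPair.G K (V := V) ↔
      u • s - f b ∈ GroupPair.G K (V := W)) :
    ∀ φ ∈ tp (langG K) r C, φ.Holds f s := by
  rw [spanSet_eq_linSpan] at hcut
  have hlt (b) (hb : b ∈ linSpan K C) (h : b < r) : f b < s :=
    (holds_belowFormula f s b).1
      (hcut _ ⟨(holds_belowFormula id r b).2 h, b, hb, Or.inl rfl⟩)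
  have hgt (b) (hb : b ∈ linSpan K C) (h : r < b) : s < f b :=
    (holds_aboveFormula f s b).1
      (hcut _ ⟨(holds_aboveFormula id r b).2 h, b, hb, Or.inr (Or.inl rfl)⟩)
  have heq (b) (hb : b ∈ linSpan K C) (h : r = b) : s = f b :=
    (holds_eqFormula f s b).1
      (hcut _ ⟨(holds_eqFormula id r b).2 h, b, hb, Or.inr (Or.inr rfl)⟩)
  have hD := isPartialIso_adjoin (f := f) (one_mem_linSpan C)
    (fun b hb => ⟨hlt b hb, fun h => by
      rcases lt_trichotomy b r with h' | h' | h'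
      exacts [h', (h.ne' (heq b hb h'.symm)).elim, (h.asymm (hgt b hb h')).elim]⟩)
    (fun b hb => ⟨hgt b hb, fun h => by
      rcases lt_trichotomy b r with h' | h' | h'
      exacts [(h.asymm (hlt b hb h')).elim, (h.ne (heq b hb h'.symm)).elim, h']⟩) hG
  obtain ⟨Q, _, i, j, hij⟩ := hD.exists_elementary_amalgam hT hV hW
  rintro φ ⟨hφ, ψ, rfl⟩
  rw [ParamFormula.Holds, Formula.realize_relabel] at hφ ⊢
  refine (j.map_formula ψ _).1 ?_
  convert (i.map_formula ψ _).2 hφ using 1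
  ext (c | k)
  · exact ((hij _ _).2 (Submodule.mem_sup_left ⟨c, subset_linSpan C c.2, rfl⟩)).symm
  · exact ((hij _ _).2
      (Submodule.mem_sup_right (Submodule.mem_span_singleton_self (r, s)))).symm

end Types

end VS

theorem mainTheorem8 {K : Type u} [Field K] [LinearOrder K] [IsStrictOrderedRing K]
    (VSGstar : (VS.langG K).Theory) (hcomp : IsModelCompanion (VS.theoryG K) VSGstar)
    (R : Type u) [(VS.langG K).Structure R] (hR : R ⊨ VSGstar) :
    (∀ C : Set R, acl (VS.langG K) C = VS.spanSet K C) ∧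
    ∀ r : R,
      (∀ C : Set R, AclIndependent (VS.langG K) C →
        Implies (VS.cut K r (acl (VS.langG K) C) ∪ VS.cosetType K r C) (tp (VS.langG K) r C)) ∧
      (FiniteDimensional ℚ K → ∀ (n : ℕ) (η : Fin n → K), 0 < n →
        (IntermediateField.adjoin ℚ (Set.range η) = ⊤ →
          ∃ d : Fin n → R, ∀ C : Set R, Set.range d ⊆ C →
            Implies (VS.cut K r (VS.spanSet K C) ∪ VS.cosetType K r (Set.range d))
              (tp (VS.langG K) r C)) ∧
        (Submodule.span ℚ (Set.range η) = ⊤ →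
          ∀ d : Fin n → R,
            (∀ j, (VS.cosetFormula (η j) 0 [(1, d j)]).Holds (L := VS.langG K) id r) →
            ∀ C : Set R, Set.range d ⊆ C →
              Implies (VS.cut K r (VS.spanSet K C) ∪ VS.cosetType K r (Set.range d))
                (tp (VS.langG K) r C))) := by
  obtain ⟨_, _, _, _, _, _, rfl⟩ := VS.exists_groupPair_of_model hcomp hR
  refine ⟨VS.acl_eq_spanSet hcomp hR, fun r => ⟨fun C _ => ?_, fun _ n η hn =>
    ⟨fun _ => ?_, fun hη d hd C _ => ?_⟩⟩⟩
  · rw [VS.acl_eq_spanSet hcomp hR]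
    intro N _ f s hs
    have hN := (f.theory_model_iff VSGstar).1 hR
    obtain ⟨_, _, _, _, _, _, rfl⟩ := VS.exists_groupPair_of_model hcomp hN
    exact VS.holds_of_mem_tp hcomp hR hN (fun φ hφ => hs φ (Or.inl hφ)) fun u b hb =>
      VS.mem_G_iff_of_cosetType (fun φ hφ => hs φ (Or.inr hφ)) u hb
  · -- For `d = r + x`, where `x ≠ 0` and `G` contains the line `K x`, each `u r` lies in the
    -- coset of `u d`.
    obtain ⟨x, hx₀, hx⟩ := VS.exists_line_subset_G hcomp hR
    refine ⟨fun _ => r + x, fun C _ N _ f s hs => ?_⟩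
    have hN := (f.theory_model_iff VSGstar).1 hR
    obtain ⟨_, _, _, _, _, _, rfl⟩ := VS.exists_groupPair_of_model hcomp hN
    refine VS.holds_of_mem_tp hcomp hR hN (fun φ hφ => hs φ (Or.inl hφ)) fun u b _ =>
      VS.mem_G_iff_of_forall_exists (fun u => ⟨u • (r + x), ?_⟩) u b
    have h : u • r - u • (r + x) ∈ VS.GroupPair.G K (V := R) := by
      rw [← smul_sub, sub_add_cancel_left, smul_neg]
      exact neg_mem (hx u)
    refine ⟨h, (VS.mem_G_iff_of_cosetType (fun φ hφ => hs φ (Or.inr hφ)) u ?_).1 h⟩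
    exact Submodule.smul_mem _ _ (VS.subset_linSpan _ ⟨⟨0, hn⟩, rfl⟩)
  · intro N _ f s hs
    have hN := (f.theory_model_iff VSGstar).1 hR
    obtain ⟨_, _, _, _, _, _, rfl⟩ := VS.exists_groupPair_of_model hcomp hN
    have hr (j : Fin n) : η j • r - d j ∈ VS.GroupPair.G K (V := R) := by
      simpa [VS.linComb] using (VS.holds_cosetFormula id r _ _ _).1 (hd j)
    refine VS.holds_of_mem_tp hcomp hR hN (fun φ hφ => hs φ (Or.inl hφ)) fun u b _ =>
      VS.mem_G_iff_of_forall_exists (VS.exists_coset_of_span_eq_top hη hr fun j => ?_) u b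
    exact (VS.mem_G_iff_of_cosetType (fun φ hφ => hs φ (Or.inr hφ)) _
      (VS.subset_linSpan _ ⟨j, rfl⟩)).1 (hr j)
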